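/- Let $p\ge 1$. A word $a_1\cdots a_n$ over $\mathbb{N}=\{0,1,2,\dots\}$ is a $p$-ascent sequence if $a_1=0$ and $0\le a_i\le p+\mathrm{asc}(a_1\cdots a_{i-1})$ for $2\le i\le n$, where $\mathrm{asc}(a_1\cdots a_m)=|\{j: 1\le j<m,\ a_j<a_{j+1}\}|$. For $r\ge 1$ let $$G^{(p)}_r(t,u,v,z)=\sum_{w} t^{|w|}u^{\mathrm{asc}(w)}v^{\mathrm{last}(w)}z^{|w|_0},$$ where $w$ runs over the $p$-ascent sequences that begin with exactly $r$ zeros followed by a nonzero letter, $|w|$ is the length of $w$, $\mathrm{last}(w)$ its last letter and $|w|_0$ its number of zeros. For each value of $(|w|,\mathrm{asc}(w),\mathrm{last}(w),|w|_0)$ there are finitely many such $w$, so that $G^{(p)}_r\in\mathbb{Z}[[t,u,v,z]]$. Put $$\delta_k=u-(1-t)^k(u-1)\quad(k\ge 0),\qquad \gamma_k=u-(1-zt)(1-t)^{k-1}(u-1)\quad(k\ge 1),$$ so that $\delta_0=1$, and let $\bar\delta_k$, $\bar\gamma_k$ be obtained from $\delta_k$, $\gamma_k$ by replacing $u$ by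 $uv$. In the ring $\mathbb{Z}[[t,u,v,z]]$ of formal power series all the $\delta_k,\bar\delta_k,\gamma_k,\bar\gamma_k$ and $v\delta_1-1$ are invertible, the two infinite sums below converge coefficientwise (each coefficient receives only finitely many nonzero contributions), and for all $r\ge 1$ $$G^{(p)}_r(t,u,v,z)=t^rz^r\left(\frac{tuv(v^p-1)}{v\delta_1-1}+\frac{t(z(v-1)-v)}{v\delta_1-1}\sum_{k\ge1}\frac{u^k(\delta_{k-1}^p-\delta_k^p)}{\gamma_1\cdots\gamma_k\,\delta_{k-1}^p\delta_k^p}+\frac{tuv^{p+1}}{v\delta_1-1}\sum_{k\ge1}\frac{(uv)^k(\bar\delta_{k-1}^p-\bar\delta_k^p)}{\bar\gamma_1\cdots\bar\gamma_k\,\bar\delta_{k-1}^p\bar\delta_k^p}\right).$$ -/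

import Mathlib

open scoped MvPowerSeries.WithPiTopology

namespace PAscent

/-- The number of ascents of a word: the number of adjacent positions `a_j < a_{j+1}`. -/
def asc : List ℕ → ℕ
  | [] => 0
  | [_] => 0
  | a :: b :: w => (if a < b then 1 else 0) + asc (b :: w)

/-- A `p`-ascent sequence: the first letter is `0`, and every later letter is at most `p` plus the
number of ascents of the word formed by the letters before it.  The empty word is one. -/
def IsPAscent (p : ℕ) (w : List ℕ) : Prop :=
  (∀ h : 0 < w.length, w[0] = 0) ∧
    ∀ i, 1 ≤ i → ∀ h : i < w.length, w[i] ≤ p + asc (w.take i)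

/-- The word `w` begins with exactly `r` zeros, followed by a nonzero letter. -/
def InitialRun (r : ℕ) (w : List ℕ) : Prop :=
  ∃ c : ℕ, c ≠ 0 ∧ (List.replicate r 0 ++ [c]) <+: w

/-- The `p`-ascent sequences that begin with `r` zeros followed by a nonzero letter and have length
`n`, `a` ascents, last letter `l` and `m` zeros in total. -/
def seqs (p r n a l m : ℕ) : Set (List ℕ) :=
  {w | IsPAscent p w ∧ InitialRun r w ∧ w.length = n ∧ asc w = a ∧ w.getLast? = some l ∧
    w.count 0 = m}

/-- Formal power series over `ℤ` in the four commuting variables `t, u, v, z`.  Infinite sums are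
taken in the product topology over the discrete ring `ℤ`, that is, coefficient by coefficient. -/
abbrev Series : Type := MvPowerSeries (Fin 4) ℤ

noncomputable section

def t : Series := MvPowerSeries.X 0
def u : Series := MvPowerSeries.X 1
def v : Series := MvPowerSeries.X 2
def z : Series := MvPowerSeries.X 3

/-- The generating function whose coefficient of `t^n u^a v^l z^m` is the number of words in
`seqs p r n a l m`. -/
def G (p r : ℕ) : Series :=
  fun e => ((seqs p r (e 0) (e 1) (e 2) (e 3)).ncard : ℤ)

/-- `δ_k`, with a general argument `x` in place of `u`; at `k = 0` this is `1`. -/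
def delta (x : Series) (k : ℕ) : Series := x - (1 - t) ^ k * (x - 1)

/-- `γ_k` for `k ≥ 1`, with a general argument `x` in place of `u`. -/
def gamma (x : Series) (k : ℕ) : Series := x - (1 - z * t) * (1 - t) ^ (k - 1) * (x - 1)

/-- `x^k (δ_{k-1}^p - δ_k^p) / (γ_1 ⋯ γ_k δ_{k-1}^p δ_k^p)` for `k ≥ 1`, where `δ` and `γ` have
argument `x`; `Ring.inverse` is the inverse on units. -/
def term (p : ℕ) (x : Series) (k : ℕ) : Series :=
  x ^ k * (delta x (k - 1) ^ p - delta x k ^ p) *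
    Ring.inverse ((∏ i ∈ Finset.Icc 1 k, gamma x i) * delta x (k - 1) ^ p * delta x k ^ p)

end

end PAscent

/-! The kernel method. Let `F(x, y)` be the generating function in which `x` marks ascents and `y`
the last letter. Summing over the letters `c ≤ p + asc w` that may follow a word `w` is summing a
geometric series in `y`, so `(1 - y δ₁(x)) F(x, y)` is a combination of `F(x, 1)` and `F(x y, 1)`,
up to a term coming from the shortest words. At `y = 1 / δ₁(x)` this expresses `F(x, 1)` through
`F(x / δ₁(x), 1)`. Because `δₖ(x) δₘ(x / δₖ(x)) = δₖ₊ₘ(x)`, iteration runs through the points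
`x / δₖ(x)`, and it converges in the power series ring because every step contributes a factor `x`.
Substituting the resulting sums for `F(u, 1)` and `F(u v, 1)` into the relation at `(u, v)` gives
`F(u, v)`. -/

namespace PAscent

theorem asc_concat {w : List ℕ} (hw : w ≠ []) (c : ℕ) :
    asc (w ++ [c]) = asc w + if w.getLastD 0 < c then 1 else 0 := by
  induction w with
  | nil => exact absurd rfl hw
  | cons a w ih =>
    cases w with
    | nil => simp [asc]
    | cons b w =>
      have h := ih (by simp)
      simp only [List.cons_append, asc] at h ⊢
      rw [h, add_assoc]
      simp

theorem asc_replicate_zero (r : ℕ) : asc (List.replicate r 0) = 0 := by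
  induction r with
  | zero => rfl
  | succ r ih =>
    cases r with
    | zero => rfl
    | succ r => simpa [List.replicate_succ, asc] using ih

theorem isPAscent_replicate_zero (p r : ℕ) : IsPAscent p (List.replicate r 0) :=
  ⟨fun _ => by simp, fun i _ _ => by simp⟩

theorem isPAscent_concat {p : ℕ} {w : List ℕ} (hw : w ≠ []) (c : ℕ) :
    IsPAscent p (w ++ [c]) ↔ IsPAscent p w ∧ c ≤ p + asc w := by
  have hl : 0 < w.length := List.length_pos_iff.mpr hw
  constructor
  · rintro ⟨h0, h⟩
    refine ⟨⟨fun _ => ?_, fun i hi hil => ?_⟩, ?_⟩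
    · simpa [List.getElem_append_left hl] using h0 (by simp)
    · have hbound := h i hi (hil.trans (by simp))
      rwa [List.getElem_append_left hil, List.take_append_of_le_length hil.le] at hbound
    · simpa using h w.length hl (by simp)
  · rintro ⟨⟨h0, h⟩, hc⟩
    refine ⟨fun _ => ?_, fun i hi hil => ?_⟩
    · simpa [List.getElem_append_left hl] using h0 hl
    · rcases lt_or_ge i w.length with hiw | hiw
      · rw [List.getElem_append_left hiw, List.take_append_of_le_length hiw.le]
        exact h i hi hiw
      · rw [List.length_append, List.length_singleton] at hil
        obtain rfl : i = w.length := by omega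
        simpa using hc

theorem IsPAscent.of_concat {p c : ℕ} {w : List ℕ} (h : IsPAscent p (w ++ [c])) :
    IsPAscent p w ∧ c ≤ p + asc w := by
  rcases eq_or_ne w [] with rfl | hw
  · obtain rfl : c = 0 := h.1 (by simp)
    exact ⟨isPAscent_replicate_zero p 0, Nat.zero_le _⟩
  · exact (isPAscent_concat hw c).1 h

theorem IsPAscent.getLastD_le {p : ℕ} {w : List ℕ} (h : IsPAscent p w) :
    w.getLastD 0 ≤ p + asc w := by
  obtain rfl | ⟨w, c, rfl⟩ := List.eq_nil_or_concat' w
  · simp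
  · rcases eq_or_ne w [] with rfl | hw
    · simpa [asc] using h.of_concat.2
    · rw [asc_concat hw, List.getLastD_concat]
      have := h.of_concat.2
      omega

theorem finite_setOf_isPAscent_length_eq (p n : ℕ) :
    {w | IsPAscent p w ∧ w.length = n}.Finite := by
  induction n with
  | zero => exact (Set.finite_singleton []).subset fun w hw => List.length_eq_zero_iff.1 hw.2
  | succ n ih =>
    refine (ih.biUnion fun w _ => (Set.finite_Iic (p + asc w)).image (w ++ [·])).subset ?_
    rintro w ⟨hw, hlen⟩
    obtain rfl | ⟨w, c, rfl⟩ := List.eq_nil_or_concat' w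
    · simp at hlen
    · exact Set.mem_biUnion ⟨hw.of_concat.1, by simpa using hlen⟩ ⟨c, hw.of_concat.2, rfl⟩

theorem finite_seqs (p r n a l m : ℕ) : (seqs p r n a l m).Finite :=
  (finite_setOf_isPAscent_length_eq p n).subset fun _ hw => ⟨hw.1, hw.2.2.1⟩

theorem InitialRun.lt_length {r : ℕ} {w : List ℕ} (h : InitialRun r w) : r < w.length := by
  obtain ⟨c, -, hprefix⟩ := h
  simpa using hprefix.length_le

theorem initialRun_concat {r : ℕ} {w : List ℕ} {c : ℕ} :
    InitialRun r (w ++ [c]) ↔ InitialRun r w ∨ w = List.replicate r 0 ∧ c ≠ 0 := by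
  simp only [InitialRun, List.prefix_concat_iff, and_or_left, exists_or]
  rw [or_comm]
  refine or_congr_right ⟨?_, ?_⟩
  · rintro ⟨d, hd, h⟩
    obtain ⟨rfl, hdc⟩ := List.append_inj' h rfl
    exact ⟨rfl, by simpa [← List.singleton_inj.1 hdc] using hd⟩
  · rintro ⟨rfl, hc⟩
    exact ⟨c, hc, rfl⟩

noncomputable section

/-- The `p`-ascent sequences of length `n` that begin with exactly `r` zeros followed by a nonzero
letter, the last letter and the numbers of ascents and of zeros being free. -/
def words (p r n : ℕ) : Finset (List ℕ) :=
  ((finite_setOf_isPAscent_length_eq p n).subset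
    (t := {w | IsPAscent p w ∧ InitialRun r w ∧ w.length = n}) fun _ hw => ⟨hw.1, hw.2.2⟩).toFinset

theorem mem_words {p r n : ℕ} {w : List ℕ} :
    w ∈ words p r n ↔ IsPAscent p w ∧ InitialRun r w ∧ w.length = n := by
  simp [words]

theorem ne_nil_of_mem_words {p r n : ℕ} {w : List ℕ} (hw : w ∈ words p r n) : w ≠ [] :=
  List.ne_nil_of_length_pos (Nat.zero_lt_of_lt (mem_words.1 hw).2.1.lt_length)

theorem words_eq_empty {p r n : ℕ} (hn : n ≤ r) : words p r n = ∅ := by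
  refine Finset.eq_empty_of_forall_notMem fun w hw => ?_
  obtain ⟨-, hrun, hlen⟩ := mem_words.1 hw
  exact absurd hrun.lt_length (by omega)

theorem words_succ_self {p r : ℕ} (hr : 1 ≤ r) :
    words p r (r + 1) = (Finset.Icc 1 p).image (List.replicate r 0 ++ [·]) := by
  have hne : List.replicate r 0 ≠ [] := List.ne_nil_of_length_pos (by rwa [List.length_replicate])
  ext w
  obtain rfl | ⟨w, c, rfl⟩ := List.eq_nil_or_concat' w
  · simp [mem_words]
  simp only [mem_words, initialRun_concat, List.length_append, List.length_singleton,
    Nat.add_right_cancel_iff, Finset.mem_image, Finset.mem_Icc]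
  constructor
  · rintro ⟨hw, hrun | ⟨rfl, hc⟩, hlen⟩
    · exact absurd hrun.lt_length (by omega)
    · exact ⟨c, ⟨by omega, by simpa [asc_replicate_zero] using hw.of_concat.2⟩, rfl⟩
  · rintro ⟨d, ⟨hd, hdp⟩, h⟩
    obtain ⟨rfl, hdc⟩ := List.append_inj' h rfl
    obtain rfl := List.singleton_inj.1 hdc
    refine ⟨(isPAscent_concat hne d).2 ⟨isPAscent_replicate_zero p r, ?_⟩, ?_, by simp⟩
    · rwa [asc_replicate_zero]
    · exact Or.inr ⟨rfl, by omega⟩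

theorem words_succ {p r n : ℕ} (hn : n ≠ r) :
    words p r (n + 1) = ((words p r n).sigma fun w => Finset.range (p + asc w + 1)).image
      fun x => x.1 ++ [x.2] := by
  ext w
  simp only [Finset.mem_image, Finset.mem_sigma, Finset.mem_range, Sigma.exists]
  constructor
  · intro hw
    obtain ⟨hasc, hrun, hlen⟩ := mem_words.1 hw
    obtain rfl | ⟨w, c, rfl⟩ := List.eq_nil_or_concat' w
    · simp at hlen
    have hlen : w.length = n := by simpa using hlen
    rcases initialRun_concat.1 hrun with hrun | ⟨rfl, -⟩
    · exact ⟨w, c, ⟨mem_words.2 ⟨hasc.of_concat.1, hrun, hlen⟩,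
        Nat.lt_succ_of_le hasc.of_concat.2⟩, rfl⟩
    · exact absurd (by simpa using hlen.symm) hn
  · rintro ⟨w, c, ⟨hw, hc⟩, rfl⟩
    obtain ⟨hasc, hrun, hlen⟩ := mem_words.1 hw
    exact mem_words.2 ⟨(isPAscent_concat (ne_nil_of_mem_words hw) c).2
      ⟨hasc, Nat.le_of_lt_succ hc⟩, initialRun_concat.2 (Or.inl hrun), by simp [hlen]⟩

theorem sum_words_succ_self {M : Type*} [AddCommMonoid M] {p r : ℕ} (hr : 1 ≤ r)
    (f : List ℕ → M) :
    ∑ w ∈ words p r (r + 1), f w = ∑ c ∈ Finset.Icc 1 p, f (List.replicate r 0 ++ [c]) := by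
  rw [words_succ_self hr, Finset.sum_image]
  exact fun _ _ _ _ h => by simpa using h

theorem sum_words_succ {M : Type*} [AddCommMonoid M] {p r n : ℕ} (hn : n ≠ r)
    (f : List ℕ → M) :
    ∑ w ∈ words p r (n + 1), f w =
      ∑ w ∈ words p r n, ∑ c ∈ Finset.range (p + asc w + 1), f (w ++ [c]) := by
  rw [words_succ hn, Finset.sum_image, Finset.sum_sigma]
  rintro ⟨w, c⟩ - ⟨w', c'⟩ - h
  obtain ⟨rfl, h⟩ := List.append_inj' h rfl
  simpa using h

theorem coe_filter_words (p r n a l m : ℕ) :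
    ((words p r n).filter fun w => asc w = a ∧ w.getLastD 0 = l ∧ w.count 0 = m : Set (List ℕ)) =
      seqs p r n a l m := by
  ext w
  simp only [Finset.coe_filter, seqs, Set.mem_ofPred_eq]
  have hlast : w ∈ words p r n → (w.getLastD 0 = l ↔ w.getLast? = some l) := fun hw => by
    rw [List.getLastD_eq_getLast?, List.getLast?_eq_some_getLast (ne_nil_of_mem_words hw)]
    simp
  rw [mem_words] at hlast ⊢
  tauto

section Weight

variable {R : Type*} [CommSemiring R] (p r n : ℕ) (x y c : R)

/-- The weight `x^asc(w) y^last(w) c^|w|_0` of a nonempty word; the empty word counts as having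
last letter `0`. -/
def weight (w : List ℕ) : R :=
  x ^ asc w * y ^ w.getLastD 0 * c ^ w.count 0

/-- The total weight of `words p r n`: the coefficient of `t^n` in the generating function. -/
def wordSum : R :=
  ∑ w ∈ words p r n, weight x y c w

variable {p r n}

theorem weight_concat {w : List ℕ} (hw : w ≠ []) (i : ℕ) :
    weight x y c (w ++ [i]) = weight x 1 c w *
      ((if w.getLastD 0 < i then x else 1) * y ^ i * if i = 0 then c else 1) := by
  simp only [weight, asc_concat hw, List.getLastD_concat, List.count_append, pow_add,
    List.count_singleton, beq_iff_eq]
  split_ifs <;> ring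

theorem wordSum_eq_zero (hn : n ≤ r) : wordSum p r n x y c = 0 := by
  rw [wordSum, words_eq_empty hn, Finset.sum_empty]

end Weight

section WordSumRecurrence

variable {R : Type*} [CommRing R] {p r n : ℕ} (x y c : R)

theorem one_sub_mul_sum_range_ite {l N : ℕ} (h : l < N) :
    (1 - y) * ∑ i ∈ Finset.range N, (if l < i then x else 1) * y ^ i * (if i = 0 then c else 1) =
      (1 - y) * (c - 1) + (1 - y ^ (l + 1)) + x * (y ^ (l + 1) - y ^ N) := by
  induction N, h using Nat.le_induction with
  | base =>
    have hsummand : ∀ i ∈ Finset.range (l + 1),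
        (if l < i then x else 1) * y ^ i * (if i = 0 then c else 1) =
          y ^ i + if i = 0 then c - 1 else 0 := by
      intro i hi
      rw [if_neg (by simpa [Nat.lt_succ_iff] using hi)]
      split_ifs with h0
      · simp [h0]
      · ring
    rw [Nat.succ_eq_add_one, Finset.sum_congr rfl hsummand, Finset.sum_add_distrib, mul_add,
      mul_neg_geom_sum, Finset.sum_ite_eq' _ 0, if_pos (by simp)]
    ring
  | succ n hn ih =>
    rw [Finset.sum_range_succ, mul_add, ih, if_pos (by omega), if_neg (by omega)]
    ring

theorem one_sub_mul_wordSum_succ_self (hr : 1 ≤ r) :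
    (1 - y) * wordSum p r (r + 1) x y c = c ^ r * (x * y * (1 - y ^ p)) := by
  have hne : List.replicate r 0 ≠ [] := List.ne_nil_of_length_pos (by rwa [List.length_replicate])
  have hlast : (List.replicate r 0).getLastD 0 = 0 := by
    simp [List.getLast?_replicate, Nat.one_le_iff_ne_zero.1 hr]
  have hweight : ∀ i ∈ Finset.Icc 1 p,
      weight x y c (List.replicate r 0 ++ [i]) = c ^ r * x * y ^ i := by
    intro i hi
    rw [Finset.mem_Icc] at hi
    rw [weight_concat x y c hne, hlast, if_pos (by omega), if_neg (by omega)]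
    simp only [weight, asc_replicate_zero, List.count_replicate_self]
    ring
  have hgeom : (1 - y) * ∑ i ∈ Finset.Icc 1 p, y ^ i = y * (1 - y ^ p) := by
    rw [← Finset.Ico_add_one_right_eq_Icc, Finset.sum_Ico_eq_sum_range]
    simp only [pow_add, pow_one, Nat.add_sub_cancel, ← Finset.mul_sum]
    rw [mul_left_comm, mul_neg_geom_sum]
  rw [wordSum, sum_words_succ_self hr, Finset.sum_congr rfl hweight, ← Finset.mul_sum]
  linear_combination c ^ r * x * hgeom

theorem one_sub_mul_wordSum_succ (hn : n ≠ r) :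
    (1 - y) * wordSum p r (n + 1) x y c =
      (c * (1 - y) + y) * wordSum p r n x 1 c + (x - 1) * y * wordSum p r n x y c -
        x * y ^ (p + 1) * wordSum p r n (x * y) 1 c := by
  simp only [wordSum, sum_words_succ hn, Finset.mul_sum _ _ (_ : R)]
  rw [← Finset.sum_add_distrib, ← Finset.sum_sub_distrib]
  refine Finset.sum_congr rfl fun w hw => ?_
  simp only [weight_concat x y c (ne_nil_of_mem_words hw)]
  rw [← Finset.mul_sum, ← Finset.mul_sum, mul_left_comm, one_sub_mul_sum_range_ite x y c
    (Nat.lt_succ_of_le (mem_words.1 hw).1.getLastD_le)]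
  simp only [weight, one_pow, mul_one, mul_pow, Nat.succ_eq_add_one]
  ring

end WordSumRecurrence

section MvPowerSeries

open MvPowerSeries Filter Topology

variable {σ R : Type*}

theorem isUnit_of_constantCoeff_eq_one [Ring R] {a : MvPowerSeries σ R}
    (h : constantCoeff a = 1) : IsUnit a := by
  rw [MvPowerSeries.isUnit_iff_constantCoeff, h]
  exact isUnit_one

variable [TopologicalSpace R]

theorem summable_pow_mul [Semiring R] {a : MvPowerSeries σ R} (ha : constantCoeff a = 0)
    (g : ℕ → MvPowerSeries σ R) :
    Summable fun k => a ^ k * g k := by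
  refine WithPiTopology.summable_of_tendsto_order_atTop_nhds_top
    (ENat.tendsto_nhds_top_iff_natCast_lt.mpr fun n => ?_)
  filter_upwards [eventually_gt_atTop n] with k hk
  calc (n : ℕ∞) < k := by exact_mod_cast hk
    _ ≤ (a ^ k).order := le_order_pow_of_constantCoeff_eq_zero k ha
    _ ≤ (a ^ k).order + (g k).order := le_self_add
    _ ≤ (a ^ k * g k).order := le_order_mul

theorem hasSum_of_mul_eq_mul_add [CommRing R] [IsTopologicalRing R] [T2Space R]
    {a : MvPowerSeries σ R} (ha : constantCoeff a = 0) {g b H : ℕ → MvPowerSeries σ R}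
    (hg : ∀ k, IsUnit (g (k + 1)))
    (hrec : ∀ k, g (k + 1) * H k = a * (b k + H (k + 1))) :
    HasSum (fun k => a ^ (k + 1) * b k * Ring.inverse (∏ i ∈ Finset.Icc 1 (k + 1), g i)) (H 0) := by
  set q : ℕ → MvPowerSeries σ R := fun k => Ring.inverse (∏ i ∈ Finset.Icc 1 k, g i) with hq
  have hq_succ (k : ℕ) : q k = g (k + 1) * q (k + 1) := by
    simp only [hq, Finset.prod_Icc_succ_top (Nat.le_add_left 1 k), Ring.mul_inverse_rev]
    rw [Ring.mul_inverse_cancel_left _ _ (hg k)]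
  have hstep (k : ℕ) :
      a ^ (k + 1) * b k * q (k + 1) =
        a ^ k * (q k * H k) - a ^ (k + 1) * (q (k + 1) * H (k + 1)) := by
    rw [hq_succ k]
    linear_combination (-a ^ k * q (k + 1)) * hrec k
  have hsummable : Summable fun k => a ^ (k + 1) * b k * q (k + 1) :=
    (summable_pow_mul ha fun k => a * b k * q (k + 1)).congr fun k => by ring
  rw [hsummable.hasSum_iff_tendsto_nat]
  have hremainder : Tendsto (fun n => a ^ n * (q n * H n)) atTop (𝓝 0) :=
    (summable_pow_mul ha fun n => q n * H n).tendsto_atTop_zero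
  have hpartial (n : ℕ) :
      ∑ k ∈ Finset.range n, a ^ (k + 1) * b k * q (k + 1) = H 0 - a ^ n * (q n * H n) := by
    simp only [hstep, Finset.sum_range_sub' fun k => a ^ k * (q k * H k)]
    simp [hq]
  simpa only [hpartial, sub_zero] using hremainder.const_sub (H 0)

end MvPowerSeries

@[simp] theorem constantCoeff_t : MvPowerSeries.constantCoeff t = 0 :=
  MvPowerSeries.constantCoeff_X 0

@[simp] theorem constantCoeff_u : MvPowerSeries.constantCoeff u = 0 :=
  MvPowerSeries.constantCoeff_X 1

@[simp] theorem constantCoeff_v : MvPowerSeries.constantCoeff v = 0 :=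
  MvPowerSeries.constantCoeff_X 2

theorem isUnit_delta {x : Series} (hx : MvPowerSeries.constantCoeff x = 0) (k : ℕ) :
    IsUnit (delta x k) :=
  isUnit_of_constantCoeff_eq_one (by simp [delta, hx])

theorem isUnit_gamma {x : Series} (hx : MvPowerSeries.constantCoeff x = 0) (k : ℕ) :
    IsUnit (gamma x k) :=
  isUnit_of_constantCoeff_eq_one (by simp [gamma, hx])

theorem isUnit_v_mul_sub_one (a : Series) : IsUnit (v * a - 1) := by
  simp [MvPowerSeries.isUnit_iff_constantCoeff]

theorem delta_mul_of_delta_mul_eq_one {x a : Series} {k : ℕ} (ha : delta x k * a = 1) (m : ℕ) :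
    delta (x * a) m = delta x (k + m) * a := by
  simp only [delta, pow_add] at *
  linear_combination (-(1 - t) ^ m) * ha

theorem gamma_mul_of_delta_mul_eq_one {x a : Series} {k : ℕ} (ha : delta x k * a = 1) (m : ℕ) :
    gamma (x * a) (m + 1) = gamma x (k + m + 1) * a := by
  simp only [delta, gamma, Nat.add_sub_cancel, pow_add] at *
  linear_combination (-(1 - z * t) * (1 - t) ^ m) * ha

/-- The generating function of the `p`-ascent sequences that begin with exactly `r` zeros followed
by a nonzero letter, with arbitrary series `x` and `y` marking the ascents and the last letter, so
that `u`, `v` can be replaced by `u v`, `1` and so on. -/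
def genFun (p r : ℕ) (x y : Series) : Series :=
  ∑' n, t ^ n * wordSum p r n x y z

theorem hasSum_genFun (p r : ℕ) (x y : Series) :
    HasSum (fun n => t ^ n * wordSum p r n x y z) (genFun p r x y) :=
  (summable_pow_mul constantCoeff_t _).hasSum

theorem pow_mul_weight_eq_monomial (w : List ℕ) (n : ℕ) :
    t ^ n * weight u v z w = MvPowerSeries.monomial
      (Finsupp.equivFunOnFinite.symm ![n, asc w, w.getLastD 0, w.count 0]) (1 : ℤ) := by
  simp only [weight, t, u, v, z, MvPowerSeries.X_pow_eq, MvPowerSeries.monomial_mul_monomial,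
    mul_one]
  congr 2
  ext i
  fin_cases i <;> simp

theorem coeff_pow_mul_weight (w : List ℕ) (n : ℕ) (e : Fin 4 →₀ ℕ) :
    MvPowerSeries.coeff e (t ^ n * weight u v z w) =
      if n = e 0 ∧ asc w = e 1 ∧ w.getLastD 0 = e 2 ∧ w.count 0 = e 3 then 1 else 0 := by
  rw [pow_mul_weight_eq_monomial, MvPowerSeries.coeff_monomial]
  refine if_congr ?_ rfl rfl
  rw [eq_comm, Equiv.symm_apply_eq, funext_iff, Fin.forall_fin_succ, Fin.forall_fin_succ,
    Fin.forall_fin_succ, Fin.forall_fin_one]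
  rfl

theorem coeff_pow_mul_wordSum (p r n : ℕ) (e : Fin 4 →₀ ℕ) :
    MvPowerSeries.coeff e (t ^ n * wordSum p r n u v z) =
      if n = e 0 then MvPowerSeries.coeff e (G p r) else 0 := by
  simp only [wordSum, Finset.mul_sum, map_sum, coeff_pow_mul_weight]
  split_ifs with hn
  · have hG : MvPowerSeries.coeff e (G p r) =
        ((seqs p r (e 0) (e 1) (e 2) (e 3)).ncard : ℤ) := rfl
    rw [hG, ← coe_filter_words, Set.ncard_coe_finset, ← hn]
    simp only [true_and, Finset.sum_boole]
  · simp [hn]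

theorem G_eq_genFun (p r : ℕ) : G p r = genFun p r u v := by
  refine HasSum.unique (MvPowerSeries.WithPiTopology.hasSum_iff_hasSum_coeff.2 fun e => ?_)
    (hasSum_genFun p r u v)
  simp only [coeff_pow_mul_wordSum]
  exact hasSum_ite_eq (e 0) _

theorem one_sub_mul_delta_one_mul_genFun (p : ℕ) {r : ℕ} (hr : 1 ≤ r) (x y : Series) :
    (1 - y * delta x 1) * genFun p r x y =
      t * (t ^ r * z ^ r * (x * y * (1 - y ^ p)) + (z * (1 - y) + y) * genFun p r x 1 -
        x * y ^ (p + 1) * genFun p r (x * y) 1) := by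
  have hrec (n : ℕ) : (1 - y) * (t ^ (n + 1) * wordSum p r (n + 1) x y z) =
      t * ((z * (1 - y) + y) * (t ^ n * wordSum p r n x 1 z) +
        (x - 1) * y * (t ^ n * wordSum p r n x y z) -
        x * y ^ (p + 1) * (t ^ n * wordSum p r n (x * y) 1 z) +
        if n = r then t ^ r * z ^ r * (x * y * (1 - y ^ p)) else 0) := by
    split_ifs with hn
    · subst hn
      simp only [wordSum_eq_zero _ _ _ le_rfl]
      linear_combination t ^ (n + 1) * one_sub_mul_wordSum_succ_self (p := p) x y z hr
    · linear_combination t ^ (n + 1) * one_sub_mul_wordSum_succ (p := p) x y z hn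
  have hright := ((((hasSum_genFun p r x 1).mul_left (z * (1 - y) + y)).add
    ((hasSum_genFun p r x y).mul_left ((x - 1) * y))).sub
    ((hasSum_genFun p r (x * y) 1).mul_left (x * y ^ (p + 1)))).add
    (hasSum_ite_eq r (t ^ r * z ^ r * (x * y * (1 - y ^ p)))) |>.mul_left t
  have hleft := (hasSum_nat_add_iff' 1).2 ((hasSum_genFun p r x y).mul_left (1 - y))
  simp only [hrec, Finset.sum_range_one, wordSum_eq_zero _ _ _ (Nat.zero_le r)] at hleft
  have heq := hleft.unique hright
  simp only [delta]
  linear_combination heq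

theorem gamma_one_mul_genFun (p : ℕ) {r : ℕ} (hr : 1 ≤ r) {x y : Series}
    (hy : delta x 1 * y = 1) :
    gamma x 1 * genFun p r x 1 =
      x * (t ^ r * z ^ r * (y ^ p - 1) + y ^ p * genFun p r (x * y) 1) := by
  have ht : t ≠ 0 := fun h => by
    simpa [t] using congrArg (MvPowerSeries.coeff (Finsupp.single 0 1)) h
  have hkernel := one_sub_mul_delta_one_mul_genFun p hr x y
  rw [show 1 - y * delta x 1 = 0 by linear_combination -hy, zero_mul, eq_comm,
    mul_eq_zero_iff_left ht] at hkernel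
  have hgamma : gamma x 1 = z * (delta x 1 - 1) + 1 := by
    simp only [gamma, delta]
    ring
  rw [hgamma]
  refine mul_left_cancel₀ (right_ne_zero_of_mul_eq_one hy) ?_
  linear_combination hkernel + z * genFun p r x 1 * hy

theorem gamma_succ_mul_inverse_delta_pow_mul_genFun (p : ℕ) {r : ℕ} (hr : 1 ≤ r) {x : Series}
    (hx : MvPowerSeries.constantCoeff x = 0) (k : ℕ) :
    gamma x (k + 1) * (Ring.inverse (delta x k) ^ p * genFun p r (x * Ring.inverse (delta x k)) 1) =
      x * (t ^ r * z ^ r * (Ring.inverse (delta x (k + 1)) ^ p - Ring.inverse (delta x k) ^ p) +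
        Ring.inverse (delta x (k + 1)) ^ p *
          genFun p r (x * Ring.inverse (delta x (k + 1))) 1) := by
  have ha := Ring.mul_inverse_cancel _ (isUnit_delta hx k)
  have hb := Ring.mul_inverse_cancel _ (isUnit_delta hx (k + 1))
  set a := Ring.inverse (delta x k)
  set b := Ring.inverse (delta x (k + 1))
  have hap : delta x k ^ p * a ^ p = 1 := by rw [← mul_pow, ha, one_pow]
  have hy : delta (x * a) 1 * (delta x k * b) = 1 := by
    rw [delta_mul_of_delta_mul_eq_one ha]
    linear_combination delta x (k + 1) * b * ha + hb
  have hgamma : gamma (x * a) 1 = gamma x (k + 1) * a := gamma_mul_of_delta_mul_eq_one ha 0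
  have hpoint : x * a * (delta x k * b) = x * b := by linear_combination x * b * ha
  have hkernel := gamma_one_mul_genFun p hr hy
  rw [hgamma, hpoint, mul_pow] at hkernel
  refine mul_left_cancel₀ (right_ne_zero_of_mul_eq_one ha) ?_
  linear_combination a ^ p * hkernel +
    x * a * b ^ p * (t ^ r * z ^ r + genFun p r (x * b) 1) * hap

theorem term_succ (p : ℕ) {x : Series} (hx : MvPowerSeries.constantCoeff x = 0) (k : ℕ) :
    term p x (k + 1) =
      x ^ (k + 1) * (Ring.inverse (delta x (k + 1)) ^ p - Ring.inverse (delta x k) ^ p) *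
        Ring.inverse (∏ i ∈ Finset.Icc 1 (k + 1), gamma x i) := by
  have hpow (j : ℕ) : delta x j ^ p * Ring.inverse (delta x j) ^ p = 1 := by
    rw [← mul_pow, Ring.mul_inverse_cancel _ (isUnit_delta hx j), one_pow]
  simp only [term, Nat.add_sub_cancel, Ring.mul_inverse_rev, ← Ring.inverse_pow]
  linear_combination x ^ (k + 1) * Ring.inverse (∏ i ∈ Finset.Icc 1 (k + 1), gamma x i) *
    (Ring.inverse (delta x (k + 1)) ^ p * hpow k - Ring.inverse (delta x k) ^ p * hpow (k + 1))

theorem summable_term (p : ℕ) {x : Series} (hx : MvPowerSeries.constantCoeff x = 0) :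
    Summable fun k => term p x (k + 1) := by
  refine (summable_pow_mul hx fun k => x * (delta x k ^ p - delta x (k + 1) ^ p) *
    Ring.inverse ((∏ i ∈ Finset.Icc 1 (k + 1), gamma x i) * delta x k ^ p *
      delta x (k + 1) ^ p)).congr fun k => ?_
  simp only [term, Nat.add_sub_cancel]
  ring

theorem genFun_one_eq_tsum (p : ℕ) {r : ℕ} (hr : 1 ≤ r) {x : Series}
    (hx : MvPowerSeries.constantCoeff x = 0) :
    genFun p r x 1 = t ^ r * z ^ r * ∑' k, term p x (k + 1) := by
  have hsum := hasSum_of_mul_eq_mul_add hx (fun k => isUnit_gamma hx (k + 1))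
    (gamma_succ_mul_inverse_delta_pow_mul_genFun p hr hx)
  have hterm := (summable_term p hx).hasSum.mul_left (t ^ r * z ^ r)
  have hzero : delta x 0 = 1 := by simp [delta]
  simp only [hzero, Ring.inverse_one, one_pow, one_mul, mul_one] at hsum
  refine hsum.unique (hterm.congr_fun fun k => ?_)
  rw [term_succ p hx]
  ring

end

end PAscent

theorem mainTheorem3 (p r : ℕ) (hp : 1 ≤ p) (hr : 1 ≤ r) :
    (∀ n a l m : ℕ, (PAscent.seqs p r n a l m).Finite) ∧
    (∀ k : ℕ, IsUnit (PAscent.delta PAscent.u k) ∧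
      IsUnit (PAscent.delta (PAscent.u * PAscent.v) k)) ∧
    (∀ k : ℕ, 1 ≤ k → IsUnit (PAscent.gamma PAscent.u k) ∧
      IsUnit (PAscent.gamma (PAscent.u * PAscent.v) k)) ∧
    IsUnit (PAscent.v * PAscent.delta PAscent.u 1 - 1) ∧
    Summable (fun k : ℕ => PAscent.term p PAscent.u (k + 1)) ∧
    Summable (fun k : ℕ => PAscent.term p (PAscent.u * PAscent.v) (k + 1)) ∧
    PAscent.G p r =
      PAscent.t ^ r * PAscent.z ^ r *
        (PAscent.t * PAscent.u * PAscent.v * (PAscent.v ^ p - 1) *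
            Ring.inverse (PAscent.v * PAscent.delta PAscent.u 1 - 1) +
          PAscent.t * (PAscent.z * (PAscent.v - 1) - PAscent.v) *
            Ring.inverse (PAscent.v * PAscent.delta PAscent.u 1 - 1) *
            ∑' k : ℕ, PAscent.term p PAscent.u (k + 1) +
          PAscent.t * PAscent.u * PAscent.v ^ (p + 1) *
            Ring.inverse (PAscent.v * PAscent.delta PAscent.u 1 - 1) *
            ∑' k : ℕ, PAscent.term p (PAscent.u * PAscent.v) (k + 1)) := by
  have huv : MvPowerSeries.constantCoeff (PAscent.u * PAscent.v) = 0 := by simp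
  have hunit := PAscent.isUnit_v_mul_sub_one (PAscent.delta PAscent.u 1)
  refine ⟨PAscent.finite_seqs p r,
    fun k => ⟨PAscent.isUnit_delta PAscent.constantCoeff_u k, PAscent.isUnit_delta huv k⟩,
    fun k _ => ⟨PAscent.isUnit_gamma PAscent.constantCoeff_u k, PAscent.isUnit_gamma huv k⟩,
    hunit, PAscent.summable_term p PAscent.constantCoeff_u, PAscent.summable_term p huv, ?_⟩
  have hfunctional := PAscent.one_sub_mul_delta_one_mul_genFun p hr PAscent.u PAscent.v
  rw [PAscent.genFun_one_eq_tsum p hr PAscent.constantCoeff_u,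
    PAscent.genFun_one_eq_tsum p hr huv, ← PAscent.G_eq_genFun] at hfunctional
  linear_combination (-Ring.inverse (PAscent.v * PAscent.delta PAscent.u 1 - 1)) * hfunctional -
    PAscent.G p r * Ring.mul_inverse_cancel _ hunit
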